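/- Let $N$ be a smooth, time-oriented Lorentzian manifold of dimension $n+1$ with metric $\bar g$ of signature $(-,+,\dots,+)$. Assume that $N$ is globally hyperbolic, and let $\mathcal S_0\subset N$ be a Cauchy hypersurface, i.e. a set which every inextendible timelike curve meets exactly once. Let $(x^\alpha)_{0\le\alpha\le n}$ be a special coordinate system associated with $\mathcal S_0$: $N$ is identified by a diffeomorphism $p\mapsto(x^0(p),\pi(p))$ with $I\times\mathcal S_0$, where $I\subset\mathbb R$ is an open interval containing $0$, $x^0$ is a smooth future oriented time function with $\{x^0=0\}=\mathcal S_0$, the $(x^i)_{1\le i\le n}$ are local coordinates of $\mathcal S_0$, and $$d\bar s^2=e^{2\psi}\{-(dx^0)^2+\sigma_{ij}(x^0,x)\,dx^i dx^j\}$$ with a smooth function $\psi$ on $N$ and Riemannian metrics $\sigma_{ij}(x^0,\cdot)$ on $\mathcal S_0$. Let $\bar\Omega\subset N$ be compact. A spacelike hypersurface is called strictly convex if its second fundamental form $(h_{ij})$, defined by the Gauss formula $x^\alpha_{ij}=h_{ij}\nu^\alpha$ with the past directed unit normal $\nu$, is positive definite at every point. A function $\chi$, of class $C^2$ in a neighbourhood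 of $\bar\Omega$, is called strictly convex on $\bar\Omega$ if there is a constant $c>0$ such that its covariant Hessian satisfies $\chi_{\alpha\beta}\eta^\alpha\eta^\beta\ge c\,\bar g_{\alpha\beta}\eta^\alpha\eta^\beta$ for all $p\in\bar\Omega$ and all $\eta\in T_pN$. Suppose that all level hypersurfaces $\{x^0=\mathrm{const}\}$ that intersect $\bar\Omega$ are strictly convex. Then there is $\lambda_0>0$ such that for every $\lambda\ge\lambda_0$ the function $\chi=e^{\lambda x^0}$ is strictly convex on $\bar\Omega$. In particular, there exists a strictly convex function $\chi\in C^2(\bar\Omega)$. -/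

import Mathlib

open Set Filter Topology
open scoped Manifold ContDiff

noncomputable section

namespace Spacetime

variable {n : ℕ}

/-- A smooth Lorentzian metric, of signature `(-, +, …, +)`, on an `(n+1)`-dimensional smooth
manifold `N`: a smooth field of symmetric bilinear forms having at each point a timelike vector on
whose orthogonal complement the form is positive definite. -/
structure LorentzianMetric (n : ℕ) (N : Type*) [TopologicalSpace N]
    [ChartedSpace (EuclideanSpace ℝ (Fin (n + 1))) N] [IsManifold (𝓡 (n + 1)) ∞ N] where
  /-- The scalar product `g(v, w)` on each tangent space. -/
  inner (p : N) :
    TangentSpace (𝓡 (n + 1)) p →L[ℝ] TangentSpace (𝓡 (n + 1)) p →L[ℝ] ℝ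
  symm (p : N) (v w : TangentSpace (𝓡 (n + 1)) p) : inner p v w = inner p w v
  lorentzian (p : N) : ∃ u : TangentSpace (𝓡 (n + 1)) p, inner p u u < 0 ∧
    ∀ v : TangentSpace (𝓡 (n + 1)) p, inner p u v = 0 → v ≠ 0 → 0 < inner p v v
  contMDiff : ContMDiff (𝓡 (n + 1))
    ((𝓡 (n + 1)).prod 𝓘(ℝ, EuclideanSpace ℝ (Fin (n + 1)) →L[ℝ]
      EuclideanSpace ℝ (Fin (n + 1)) →L[ℝ] ℝ)) ∞
    (fun p : N ↦ Bundle.TotalSpace.mk' (EuclideanSpace ℝ (Fin (n + 1)) →L[ℝ]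
      EuclideanSpace ℝ (Fin (n + 1)) →L[ℝ] ℝ)
      (E := fun p : N ↦ TangentSpace (𝓡 (n + 1)) p →L[ℝ] TangentSpace (𝓡 (n + 1)) p →L[ℝ] ℝ)
      p (inner p))

variable {N : Type*} [TopologicalSpace N] [ChartedSpace (EuclideanSpace ℝ (Fin (n + 1))) N]
  [IsManifold (𝓡 (n + 1)) ∞ N]

/-! ### Time orientation and causality -/

/-- A time orientation: a continuous timelike vector field. -/
structure TimeOrientation (g : LorentzianMetric n N) where
  field (p : N) : TangentSpace (𝓡 (n + 1)) p
  timelike (p : N) : g.inner p (field p) (field p) < 0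
  continuous : Continuous fun p : N ↦ (⟨p, field p⟩ : TangentBundle (𝓡 (n + 1)) N)

variable (g : LorentzianMetric n N) (T : TimeOrientation g)

/-- `v` is a future directed causal vector. -/
def FutureCausal (p : N) (v : TangentSpace (𝓡 (n + 1)) p) : Prop :=
  v ≠ 0 ∧ g.inner p v v ≤ 0 ∧ g.inner p v (T.field p) < 0

/-- `v` is a future directed timelike vector. -/
def FutureTimelike (p : N) (v : TangentSpace (𝓡 (n + 1)) p) : Prop :=
  g.inner p v v < 0 ∧ g.inner p v (T.field p) < 0

/-- `p` and `q` are joined by a smooth future directed causal curve segment from `p` to `q`. -/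
def CausalSegment (p q : N) : Prop :=
  ∃ γ : ℝ → N, ContMDiffOn 𝓘(ℝ, ℝ) (𝓡 (n + 1)) ∞ γ (Icc 0 1) ∧ γ 0 = p ∧ γ 1 = q ∧
    ∀ s ∈ Icc (0 : ℝ) 1, FutureCausal g T (γ s)
      (mfderivWithin 𝓘(ℝ, ℝ) (𝓡 (n + 1)) γ (Icc 0 1) s (1 : ℝ))

/-- The causal relation `p ≤ q`: `p = q`, or there is a piecewise smooth future directed causal
curve from `p` to `q`. -/
def CausallyPrecedes : N → N → Prop :=
  Relation.ReflTransGen (CausalSegment g T)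

/-- The causal diamond `J⁺(p) ∩ J⁻(q)`, i.e. the set of points that lie on causal curves
from `p` to `q` (together with `p` itself if `p = q`). -/
def causalDiamond (p q : N) : Set N :=
  {r | CausallyPrecedes g T p r ∧ CausallyPrecedes g T r q}

/-- Strong causality: every neighbourhood `U` of a point contains a smaller neighbourhood `V` such
that each causal curve with endpoints in `V` stays in `U`. -/
def StronglyCausal : Prop :=
  ∀ p : N, ∀ U ∈ 𝓝 p, ∃ V ∈ 𝓝 p, V ⊆ U ∧ ∀ q₁ ∈ V, ∀ q₂ ∈ V, causalDiamond g T q₁ q₂ ⊆ U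

/-- Global hyperbolicity: strong causality and compactness of all causal diamonds. -/
def GloballyHyperbolic : Prop :=
  StronglyCausal g T ∧ ∀ p q : N, IsCompact (causalDiamond g T p q)

/-- An inextendible (future directed, smooth) timelike curve: it has no endpoints in `N`. Such a
curve is defined on an open interval, which after a change of the parameter is all of `ℝ`. -/
def InextendibleTimelikeCurve (γ : ℝ → N) : Prop :=
  ContMDiff 𝓘(ℝ, ℝ) (𝓡 (n + 1)) ∞ γ ∧
    (∀ s : ℝ, FutureTimelike g T (γ s) (mfderiv 𝓘(ℝ, ℝ) (𝓡 (n + 1)) γ s (1 : ℝ))) ∧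
    (∀ p : N, ¬ Tendsto γ atTop (𝓝 p)) ∧ (∀ p : N, ¬ Tendsto γ atBot (𝓝 p))

/-- A Cauchy hypersurface: a set met exactly once by every inextendible timelike curve. -/
def IsCauchyHypersurface (S₀ : Set N) : Prop :=
  ∀ γ : ℝ → N, InextendibleTimelikeCurve g T γ → ∃! s : ℝ, γ s ∈ S₀

/-! ### Special coordinate systems -/

/-- The differential `df_p` of a real function, as a linear form on `T_p N`. -/
def differential (f : N → ℝ) (p : N) : TangentSpace (𝓡 (n + 1)) p →L[ℝ] ℝ :=
  mfderiv (𝓡 (n + 1)) 𝓘(ℝ, ℝ) f p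

/-- A special coordinate system associated with the Cauchy hypersurface `S₀`. It identifies `N`
with `I × S`, `I` an open interval containing `0` and `S` an `n`-dimensional manifold (a copy of
`S₀`), by a diffeomorphism `p ↦ (x⁰(p), π(p))` such that `x⁰` is future oriented,
`S₀ = {x⁰ = 0}`, and the metric is `e^{2ψ} (-(dx⁰)² + σ_{ij}(x⁰, x) dxⁱ dxʲ)` with Riemannian
metrics `σ(x⁰, ·)` on `S`. (The smoothness of `σ` follows from that of `g` and `ψ`.) -/
structure SpecialCoordinates (S : Type*) [TopologicalSpace S]
    [ChartedSpace (EuclideanSpace ℝ (Fin n)) S] [IsManifold (𝓡 n) ∞ S] (S₀ : Set N) where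
  /-- The interval of values of the time function. -/
  I : Set ℝ
  isOpen_I : IsOpen I
  ordConnected_I : I.OrdConnected
  zero_mem_I : (0 : ℝ) ∈ I
  /-- The time function `x⁰`. -/
  time : N → ℝ
  /-- The spatial component `π : N → S`; coordinates `(xⁱ)` of `S` give the remaining `xⁱ`. -/
  proj : N → S
  /-- The inverse map; `slice t` parametrizes the level hypersurface `{x⁰ = t}`. -/
  slice : ℝ → S → N
  time_mem (p : N) : time p ∈ I
  slice_time_proj (p : N) : slice (time p) (proj p) = p
  time_slice (t : ℝ) (ht : t ∈ I) (s : S) : time (slice t s) = t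
  proj_slice (t : ℝ) (ht : t ∈ I) (s : S) : proj (slice t s) = s
  contMDiff_time : ContMDiff (𝓡 (n + 1)) 𝓘(ℝ, ℝ) ∞ time
  contMDiff_proj : ContMDiff (𝓡 (n + 1)) (𝓡 n) ∞ proj
  contMDiffOn_slice : ContMDiffOn (𝓘(ℝ, ℝ).prod (𝓡 n)) (𝓡 (n + 1)) ∞
    (fun y : ℝ × S ↦ slice y.1 y.2) (I ×ˢ univ)
  /-- `x⁰` is strictly increasing along future directed causal curves. -/
  time_future (p : N) (v : TangentSpace (𝓡 (n + 1)) p) (hv : FutureCausal g T p v) :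
    0 < differential time p v
  time_eq_zero : {p | time p = 0} = S₀
  /-- The conformal exponent. -/
  ψ : N → ℝ
  contMDiff_ψ : ContMDiff (𝓡 (n + 1)) 𝓘(ℝ, ℝ) ∞ ψ
  /-- The Riemannian metrics on the slices. -/
  σ (t : ℝ) (s : S) : TangentSpace (𝓡 n) s →L[ℝ] TangentSpace (𝓡 n) s →L[ℝ] ℝ
  σ_symm (t : ℝ) (ht : t ∈ I) (s : S) (a b : TangentSpace (𝓡 n) s) : σ t s a b = σ t s b a
  σ_pos (t : ℝ) (ht : t ∈ I) (s : S) (a : TangentSpace (𝓡 n) s) (ha : a ≠ 0) : 0 < σ t s a a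
  metric_eq (p : N) (v w : TangentSpace (𝓡 (n + 1)) p) :
    g.inner p v w = Real.exp (2 * ψ p) *
      (-(differential time p v * differential time p w) +
        σ (time p) (proj p) (mfderiv (𝓡 (n + 1)) (𝓡 n) proj p v)
          (mfderiv (𝓡 (n + 1)) (𝓡 n) proj p w))

/-! ### Levi-Civita connection, Hessian and second fundamental form

Everything is expressed in the preferred chart `φ` at the point `p` under consideration. Mathlib
identifies `T_p N` with the model space through this chart. The resulting Hessian and second
fundamental form are tensors, so they do not depend on the choice of the chart. -/

/-- The coordinate expression `x ↦ (g_{αβ}(x))`, as a bilinear form on the model space, of the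
metric in the chart at `p`. -/
def coordMetric (p : N) (x : EuclideanSpace ℝ (Fin (n + 1))) :
    EuclideanSpace ℝ (Fin (n + 1)) →L[ℝ] EuclideanSpace ℝ (Fin (n + 1)) →L[ℝ] ℝ :=
  let A : EuclideanSpace ℝ (Fin (n + 1)) →L[ℝ]
      TangentSpace (𝓡 (n + 1)) ((extChartAt (𝓡 (n + 1)) p).symm x) :=
    mfderiv 𝓘(ℝ, EuclideanSpace ℝ (Fin (n + 1))) (𝓡 (n + 1)) (extChartAt (𝓡 (n + 1)) p).symm x
  (A.precomp ℝ) ∘L (g.inner ((extChartAt (𝓡 (n + 1)) p).symm x)) ∘L A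

/-- The Christoffel symbols at `p` in the chart at `p`: `Γ(v, w) = (Γ^α_{βγ} v^β w^γ)` is the vector
determined by `g(Γ(v, w), z) = ½ (∂_v g(w, z) + ∂_w g(v, z) - ∂_z g(v, w))` for all `z`. -/
def christoffel (p : N) (v w : EuclideanSpace ℝ (Fin (n + 1))) : EuclideanSpace ℝ (Fin (n + 1)) :=
  let x := extChartAt (𝓡 (n + 1)) p p
  let D := fderiv ℝ (coordMetric g p) x
  (coordMetric g p x).inverse ((1 / 2 : ℝ) • (D v w + D w v - (D.flip v).flip w))

/-- The Hessian `f_{αβ} = ∂_α ∂_β f - Γ^γ_{αβ} ∂_γ f` of a function `f` at `p`. -/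
def hessian (f : N → ℝ) (p : N) (v w : TangentSpace (𝓡 (n + 1)) p) : ℝ :=
  let F : EuclideanSpace ℝ (Fin (n + 1)) → ℝ := f ∘ (extChartAt (𝓡 (n + 1)) p).symm
  let x := extChartAt (𝓡 (n + 1)) p p
  fderiv ℝ (fderiv ℝ F) x v w - fderiv ℝ F x (christoffel g p v w)

/-- A function `χ`, of class `C²` in a neighbourhood of `K`, is strictly convex on `K` if
`χ_{αβ} ≥ c g_{αβ}` on `K` with a constant `c > 0`. -/
def StrictlyConvexOn (χ : N → ℝ) (K : Set N) : Prop :=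
  (∃ U : Set N, IsOpen U ∧ K ⊆ U ∧ ContMDiffOn (𝓡 (n + 1)) 𝓘(ℝ, ℝ) 2 χ U) ∧
    ∃ c : ℝ, 0 < c ∧ ∀ p ∈ K, ∀ v : TangentSpace (𝓡 (n + 1)) p,
      c * g.inner p v v ≤ hessian g χ p v v

variable {S : Type*} [TopologicalSpace S] [ChartedSpace (EuclideanSpace ℝ (Fin n)) S]

/-- `ν` is the past directed unit normal at `F s` of the spacelike hypersurface `F : S → N`. -/
def IsPastUnitNormal (F : S → N) (s : S) (ν : TangentSpace (𝓡 (n + 1)) (F s)) : Prop :=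
  g.inner (F s) ν ν = -1 ∧ 0 < g.inner (F s) ν (T.field (F s)) ∧
    ∀ v : TangentSpace (𝓡 n) s, g.inner (F s) ν (mfderiv (𝓡 n) (𝓡 (n + 1)) F s v) = 0

/-- The second fundamental form at `s` of a spacelike hypersurface `F : S → N` with respect to the
timelike unit normal `ν`, defined by the Gauss formula `x_{ij}^α = h_{ij} ν^α`, i.e.
`h_{ij} = -⟨x_{ij}, ν⟩`, where `x_{ij} = ∂_i ∂_j x - Γ^k_{ij} x_k + Γ(x_i, x_j)` and the
tangential term `Γ^k_{ij} x_k` drops out in the product with `ν`. -/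
def secondFundamentalForm (F : S → N) (s : S) (ν : TangentSpace (𝓡 (n + 1)) (F s))
    (v w : TangentSpace (𝓡 n) s) : ℝ :=
  let X : EuclideanSpace ℝ (Fin n) → EuclideanSpace ℝ (Fin (n + 1)) :=
    extChartAt (𝓡 (n + 1)) (F s) ∘ F ∘ (extChartAt (𝓡 n) s).symm
  let y := extChartAt (𝓡 n) s s
  let a : EuclideanSpace ℝ (Fin (n + 1)) :=
    fderiv ℝ (fderiv ℝ X) y v w + christoffel g (F s) (fderiv ℝ X y v) (fderiv ℝ X y w);
  -(g.inner (F s) a ν)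

/-- A spacelike hypersurface `F : S → N` is strictly convex if its second fundamental form with
respect to the past directed normal is positive definite at every point. -/
def StrictlyConvexHypersurface (F : S → N) : Prop :=
  ∀ s : S, ∃ ν : TangentSpace (𝓡 (n + 1)) (F s), IsPastUnitNormal g T F s ν ∧
    ∀ v : TangentSpace (𝓡 n) s, v ≠ 0 → 0 < secondFundamentalForm g F s ν v v

end Spacetime

end

/-!
The Hessian of `e^{μ f}` is `μ e^{μ f} (f_{αβ} + μ f_α f_β)`. If `f_{αβ}` is positive definite on
the kernel of `df`, then the bracket is positive definite for large `μ`, because the second term is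
positive away from this kernel; by compactness the choice of `μ` and of the convexity constant can
be made uniformly on `K` (`exists_strictlyConvexOn_exp_mul`).

The time function `x⁰` satisfies this condition at the points of `K`. Differentiating the constant
function `x⁰ ∘ F` twice, where `F` parametrizes a slice, gives `x⁰_{αβ} F^α_i F^β_j = -dx⁰(x_{ij})`,
with `x_{ij}` as in the Gauss formula. The past directed normal `ν` of the slice satisfies
`⟨ν, ·⟩ = k dx⁰` with `k > 0`, so `h_{ij} = k x⁰_{αβ} F^α_i F^β_j`
(`secondFundamentalForm_eq_mul_hessian`, `hessian_time_slice_pos`).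

The Hessian at `q` is defined in the preferred chart at `q`, which depends on `q` in an arbitrary
way. The compactness argument needs continuity in the point, and hence the tensor property of the
Hessian: near a fixed point `p` it may be computed in the single chart at `p`
(`flatHessian_comp`, `hessian_eq_flatHessian_coordVector`).
-/

namespace Spacetime

/-! ### Hessians in a normed space -/

section Flat

set_option maxSynthPendingDepth 3

variable {E H : Type*} [NormedAddCommGroup E] [NormedSpace ℝ E] [NormedAddCommGroup H]
  [NormedSpace ℝ H]

/-- The covector `z ↦ ½ (∂_v G(w, z) + ∂_w G(v, z) - ∂_z G(v, w))` at `x`, i.e. the Christoffel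
symbols of the first kind, contracted with `v` and `w`, of a field `G` of bilinear forms. -/
noncomputable def koszul (G : E → E →L[ℝ] E →L[ℝ] ℝ) (x v w : E) : E →L[ℝ] ℝ :=
  (1 / 2 : ℝ) • (fderiv ℝ G x v w + fderiv ℝ G x w v - ((fderiv ℝ G x).flip v).flip w)

/-- The covariant Hessian of `F` at `x` with respect to a field `G` of bilinear forms on a normed
space. -/
noncomputable def flatHessian (G : E → E →L[ℝ] E →L[ℝ] ℝ) (F : E → ℝ) (x v w : E) : ℝ :=
  fderiv ℝ (fderiv ℝ F) x v w - fderiv ℝ F x ((G x).inverse (koszul G x v w))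

theorem koszul_apply (G : E → E →L[ℝ] E →L[ℝ] ℝ) (x v w z : E) :
    koszul G x v w z =
      1 / 2 * (fderiv ℝ G x v w z + fderiv ℝ G x w v z - fderiv ℝ G x z v w) := by
  simp [koszul]

theorem flatHessian_congr {G : E → E →L[ℝ] E →L[ℝ] ℝ} {F F' : E → ℝ} {x : E} (h : F =ᶠ[𝓝 x] F') :
    flatHessian G F x = flatHessian G F' x := by
  ext v w
  rw [flatHessian, flatHessian, h.fderiv_eq, h.fderiv.fderiv_eq]

theorem flatHessian_smul_smul (G : E → E →L[ℝ] E →L[ℝ] ℝ) (F : E → ℝ) (x : E) (r : ℝ) (v : E) :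
    flatHessian G F x (r • v) (r • v) = r ^ 2 * flatHessian G F x v v := by
  have h : koszul G x (r • v) (r • v) = r ^ 2 • koszul G x v v := by
    ext z
    simp only [koszul_apply, map_smul, smul_apply, smul_eq_mul]
    ring
  simp only [flatHessian, h, map_smul, smul_apply, smul_eq_mul]
  ring

theorem fderiv_fderiv_comp_apply {F : E → ℝ} {θ : H → E} {x : H} (hF : ContDiffAt ℝ 2 F (θ x))
    (hθ : ContDiffAt ℝ 2 θ x) (v w : H) :
    fderiv ℝ (fderiv ℝ (F ∘ θ)) x v w =
      fderiv ℝ (fderiv ℝ F) (θ x) (fderiv ℝ θ x v) (fderiv ℝ θ x w) +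
        fderiv ℝ F (θ x) (fderiv ℝ (fderiv ℝ θ) x v w) := by
  have hF1 : ∀ᶠ y in 𝓝 x, ContDiffAt ℝ 2 F (θ y) :=
    hθ.continuousAt.eventually (hF.eventually (by simp))
  have hθ1 : ∀ᶠ y in 𝓝 x, ContDiffAt ℝ 2 θ y := hθ.eventually (by simp)
  have h : fderiv ℝ (F ∘ θ) =ᶠ[𝓝 x] fun y ↦ (fderiv ℝ F (θ y)).comp (fderiv ℝ θ y) := by
    filter_upwards [hF1, hθ1] with y hy hy'
    exact fderiv_comp y (hy.differentiableAt (by simp)) (hy'.differentiableAt (by simp))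
  have hF2 : DifferentiableAt ℝ (fderiv ℝ F) (θ x) :=
    (hF.fderiv_right (m := 1) (by norm_num)).differentiableAt (by simp)
  have hθ2 : DifferentiableAt ℝ (fderiv ℝ θ) x :=
    (hθ.fderiv_right (m := 1) (by norm_num)).differentiableAt (by simp)
  have h2 := (hF2.hasFDerivAt.comp x (hθ.differentiableAt (by simp)).hasFDerivAt).clm_comp
    hθ2.hasFDerivAt
  rw [h.fderiv_eq]
  erw [h2.fderiv]
  simp [add_comm]

/-- Product rule for the coordinate expression of a metric under a change of coordinates `θ`. -/
theorem fderiv_pullback_apply {G : E → E →L[ℝ] E →L[ℝ] ℝ} {G' : H → H →L[ℝ] H →L[ℝ] ℝ}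
    {θ : H → E} {x : H} (hG : DifferentiableAt ℝ G (θ x)) (hG' : DifferentiableAt ℝ G' x)
    (hθ : ContDiffAt ℝ 2 θ x)
    (h : ∀ᶠ y in 𝓝 x, ∀ v w, G' y v w = G (θ y) (fderiv ℝ θ y v) (fderiv ℝ θ y w))
    (u v w : H) :
    fderiv ℝ G' x u v w = fderiv ℝ G (θ x) (fderiv ℝ θ x u) (fderiv ℝ θ x v) (fderiv ℝ θ x w) +
      G (θ x) (fderiv ℝ (fderiv ℝ θ) x u v) (fderiv ℝ θ x w) +
      G (θ x) (fderiv ℝ θ x v) (fderiv ℝ (fderiv ℝ θ) x u w) := by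
  have hθ2 : DifferentiableAt ℝ (fderiv ℝ θ) x :=
    (hθ.fderiv_right (m := 1) (by norm_num)).differentiableAt (by simp)
  have h1 := (hG'.hasFDerivAt.clm_apply (hasFDerivAt_const v x)).clm_apply (hasFDerivAt_const w x)
  have hv := hθ2.hasFDerivAt.clm_apply (hasFDerivAt_const v x)
  have hw := hθ2.hasFDerivAt.clm_apply (hasFDerivAt_const w x)
  have hGθ : HasFDerivAt (fun y ↦ G (θ y)) ((fderiv ℝ G (θ x)).comp (fderiv ℝ θ x)) x :=
    hG.hasFDerivAt.comp x (hθ.differentiableAt (by simp)).hasFDerivAt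
  have h2 := (hGθ.clm_apply hv).clm_apply hw
  have h3 : (fun y ↦ G' y v w) =ᶠ[𝓝 x]
      fun y ↦ G (θ y) (fderiv ℝ θ y v) (fderiv ℝ θ y w) := by
    filter_upwards [h] with y hy using hy v w
  have h4 := congrArg (fun L ↦ L u) (h1.unique (h2.congr_of_eventuallyEq h3))
  simp at h4
  rw [h4]
  ring

/-- The covariant Hessian is a tensor: under a change of coordinates `θ`, the second derivatives
of `θ` entering `∂_α ∂_β F` cancel against those in the Christoffel symbols. -/
theorem flatHessian_comp {G : E → E →L[ℝ] E →L[ℝ] ℝ} {G' : H → H →L[ℝ] H →L[ℝ] ℝ}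
    {θ : H → E} {F : E → ℝ} {x : H} (hG : DifferentiableAt ℝ G (θ x))
    (hG' : DifferentiableAt ℝ G' x) (hF : ContDiffAt ℝ 2 F (θ x)) (hθ : ContDiffAt ℝ 2 θ x)
    (h : ∀ᶠ y in 𝓝 x, ∀ v w, G' y v w = G (θ y) (fderiv ℝ θ y v) (fderiv ℝ θ y w))
    (hsymm : ∀ v w, G (θ x) v w = G (θ x) w v)
    (hi : (G (θ x)).IsInvertible) (hi' : (G' x).IsInvertible)
    (hs : Function.Surjective (fderiv ℝ θ x)) (v w : H) :
    flatHessian G' (F ∘ θ) x v w =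
      flatHessian G F (θ x) (fderiv ℝ θ x v) (fderiv ℝ θ x w) := by
  have hsym2 : ∀ a b, fderiv ℝ (fderiv ℝ θ) x a b = fderiv ℝ (fderiv ℝ θ) x b a := fun a b ↦
    (hθ.isSymmSndFDerivAt (by simp)).eq a b
  set Γ := (G (θ x)).inverse (koszul G (θ x) (fderiv ℝ θ x v) (fderiv ℝ θ x w)) with hΓ
  set Γ' := (G' x).inverse (koszul G' x v w) with hΓ'
  -- The transformation law of the Christoffel symbols.
  have e : fderiv ℝ θ x Γ' = Γ + fderiv ℝ (fderiv ℝ θ) x v w := by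
    apply hi.injective
    ext z
    obtain ⟨z, rfl⟩ := hs z
    rw [← h.self_of_nhds, hΓ', hi'.self_apply_inverse, map_add, add_apply, hΓ,
      hi.self_apply_inverse, koszul_apply, koszul_apply, fderiv_pullback_apply hG hG' hθ h,
      fderiv_pullback_apply hG hG' hθ h, fderiv_pullback_apply hG hG' hθ h, hsym2 w v, hsym2 z v,
      hsym2 z w, hsymm (fderiv ℝ (fderiv ℝ θ) x v z)]
    ring
  have e1 : fderiv ℝ (F ∘ θ) x = (fderiv ℝ F (θ x)).comp (fderiv ℝ θ x) :=
    fderiv_comp x (hF.differentiableAt (by simp)) (hθ.differentiableAt (by simp))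
  rw [flatHessian, flatHessian, fderiv_fderiv_comp_apply hF hθ, e1, ← hΓ, ← hΓ',
    ContinuousLinearMap.comp_apply, e, map_add]
  ring

theorem continuousAt_flatHessian [CompleteSpace E] {G : E → E →L[ℝ] E →L[ℝ] ℝ} {F : E → ℝ}
    {x v : E} (hG : ContDiffAt ℝ 1 G x) (hF : ContDiffAt ℝ 2 F x) (hi : (G x).IsInvertible) :
    ContinuousAt (fun y : E × E ↦ flatHessian G F y.1 y.2 y.2) (x, v) := by
  have h1 : ContinuousAt (fun y : E × E ↦ fderiv ℝ F y.1) (x, v) :=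
    ContinuousAt.comp (f := Prod.fst) (x := (x, v))
      (hF.fderiv_right (m := 1) (by norm_num)).continuousAt continuousAt_fst
  have h2 : ContinuousAt (fun y : E × E ↦ fderiv ℝ (fderiv ℝ F) y.1) (x, v) :=
    ContinuousAt.comp (f := Prod.fst) (x := (x, v))
      ((hF.fderiv_right (m := 1) (by norm_num)).fderiv_right (m := 0) (by norm_num)).continuousAt
      continuousAt_fst
  have h3 : ContinuousAt (fun y : E × E ↦ fderiv ℝ G y.1) (x, v) :=
    ContinuousAt.comp (f := Prod.fst) (x := (x, v))
      (hG.fderiv_right (m := 0) (by norm_num)).continuousAt continuousAt_fst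
  have h4 : ContinuousAt (fun y : E × E ↦ (G y.1).inverse) (x, v) :=
    ContinuousAt.comp (g := fun z ↦ (G z).inverse) (f := Prod.fst) (x := (x, v))
      (ContinuousAt.comp (g := ContinuousLinearMap.inverse)
        (hi.contDiffAt_map_inverse (n := 0)).continuousAt hG.continuousAt) continuousAt_fst
  have h5 : ContinuousAt (fun y : E × E ↦ y.2) (x, v) := continuousAt_snd
  have h6 : ContinuousAt (fun y : E × E ↦ (fderiv ℝ G y.1).flip) (x, v) :=
    (ContinuousLinearMap.flipₗᵢ ℝ E E (E →L[ℝ] ℝ)).continuous.continuousAt.comp h3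
  have h7 : ContinuousAt (fun y : E × E ↦ ((fderiv ℝ G y.1).flip y.2).flip) (x, v) :=
    (ContinuousLinearMap.flipₗᵢ ℝ E E ℝ).continuous.continuousAt.comp (h6.clm_apply h5)
  have h8 : ContinuousAt (fun y : E × E ↦ fderiv ℝ G y.1 y.2 y.2) (x, v) :=
    (h3.clm_apply h5).clm_apply h5
  have h9 : ContinuousAt (fun y : E × E ↦ koszul G y.1 y.2 y.2) (x, v) :=
    ((h8.add h8).sub (h7.clm_apply h5)).const_smul (1 / 2 : ℝ)
  exact ((h2.clm_apply h5).clm_apply h5).sub (h1.clm_apply (h4.clm_apply h9))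

/-- The Hessian of `e^{μF}` is `μ e^{μF} (F_{αβ} + μ F_α F_β)`. -/
theorem flatHessian_exp_mul {G : E → E →L[ℝ] E →L[ℝ] ℝ} {F : E → ℝ} {x : E} (μ : ℝ)
    (hF : ContDiffAt ℝ 2 F x) (v w : E) :
    flatHessian G (fun y ↦ Real.exp (μ * F y)) x v w =
      μ * Real.exp (μ * F x) * (flatHessian G F x v w + μ * (fderiv ℝ F x v * fderiv ℝ F x w)) := by
  have hd : ∀ y, ContDiffAt ℝ 2 F y → HasFDerivAt (fun y ↦ Real.exp (μ * F y))
      ((μ * Real.exp (μ * F y)) • fderiv ℝ F y) y := by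
    intro y hy
    have := ((hy.differentiableAt (by simp)).hasFDerivAt.const_mul μ).exp
    rwa [smul_smul, mul_comm] at this
  have h : fderiv ℝ (fun y ↦ Real.exp (μ * F y)) =ᶠ[𝓝 x]
      fun y ↦ (μ * Real.exp (μ * F y)) • fderiv ℝ F y := by
    filter_upwards [hF.eventually (by simp)] with y hy using (hd y hy).fderiv
  have hF2 : DifferentiableAt ℝ (fderiv ℝ F) x :=
    (hF.fderiv_right (m := 1) (by norm_num)).differentiableAt (by simp)
  have h2 := ((hd x hF).const_mul μ).smul hF2.hasFDerivAt
  rw [flatHessian, flatHessian, h.fderiv_eq, (hd x hF).fderiv]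
  erw [h2.fderiv]
  simp
  ring

/-- Let `q`, `d`, `m` be families, parametrized by `y`, of functions on a finite dimensional space,
where `q` and `m` are homogeneous of degree two and `d` is homogeneous of degree one. If at `y = x`
the function `q` is positive on the nonzero zeros of `d`, then `c m ≤ q + μ d ^ 2` for all large
`μ`, all small `c ≥ 0`, and all `y` near `x`. Since `m` may be indefinite, the estimate for one `c`
would not imply that for smaller ones. -/
theorem exists_forall_le_add_mul_sq [FiniteDimensional ℝ E] {q d m : E → E → ℝ} {x : E}
    (hq : ∀ v, ContinuousAt (fun y : E × E ↦ q y.1 y.2) (x, v))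
    (hd : ∀ v, ContinuousAt (fun y : E × E ↦ d y.1 y.2) (x, v))
    (hm : ∀ v, ContinuousAt (fun y : E × E ↦ m y.1 y.2) (x, v))
    (hq2 : ∀ y (r : ℝ) v, q y (r • v) = r ^ 2 * q y v)
    (hd1 : ∀ y (r : ℝ) v, d y (r • v) = r * d y v)
    (hm2 : ∀ y (r : ℝ) v, m y (r • v) = r ^ 2 * m y v)
    (hpos : ∀ v, v ≠ 0 → d x v = 0 → 0 < q x v) :
    ∃ Λ ε : ℝ, 0 < Λ ∧ 0 < ε ∧ ∀ᶠ y in 𝓝 x, ∀ v, ∀ μ, Λ ≤ μ → ∀ c, 0 ≤ c → c ≤ ε →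
      c * m y v ≤ q y v + μ * d y v ^ 2 := by
  suffices h : ∃ Λ ε : ℝ, 0 < Λ ∧ 0 < ε ∧ ∀ᶠ y in 𝓝 x, ∀ v ∈ Metric.sphere (0 : E) 1,
      ∀ μ, Λ ≤ μ → ∀ c, 0 ≤ c → c ≤ ε → c * m y v ≤ q y v + μ * d y v ^ 2 by
    obtain ⟨Λ, ε, hΛ, hε, h⟩ := h
    refine ⟨Λ, ε, hΛ, hε, h.mono fun y hy v μ hμ c hc hcε ↦ ?_⟩
    rcases eq_or_ne v 0 with rfl | hv
    · have h1 := hq2 y 0 0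
      have h2 := hd1 y 0 0
      have h3 := hm2 y 0 0
      simp only [smul_zero, zero_mul, ne_eq, OfNat.ofNat_ne_zero, not_false_eq_true, zero_pow]
        at h1 h2 h3
      simp [h1, h2, h3]
    · have hv0 : 0 < ‖v‖ := norm_pos_iff.2 hv
      have h1 := hy (‖v‖⁻¹ • v) (by simp [norm_smul, hv0.ne']) μ hμ c hc hcε
      rw [hq2, hd1, hm2] at h1
      have h2 : 0 < (‖v‖⁻¹) ^ 2 := by positivity
      refine le_of_mul_le_mul_left ?_ h2
      linarith
  refine (isCompact_sphere (0 : E) 1).induction_on (p := fun s ↦ ∃ Λ ε : ℝ, 0 < Λ ∧ 0 < ε ∧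
    ∀ᶠ y in 𝓝 x, ∀ v ∈ s, ∀ μ, Λ ≤ μ → ∀ c, 0 ≤ c → c ≤ ε →
      c * m y v ≤ q y v + μ * d y v ^ 2) ⟨1, 1, by simp⟩ ?_ ?_ ?_
  · rintro s t hst ⟨Λ, ε, hΛ, hε, h⟩
    exact ⟨Λ, ε, hΛ, hε, h.mono fun y hy v hv ↦ hy v (hst hv)⟩
  · rintro s t ⟨Λ, ε, hΛ, hε, h⟩ ⟨Λ', ε', hΛ', hε', h'⟩
    refine ⟨max Λ Λ', min ε ε', by positivity, by positivity, ?_⟩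
    filter_upwards [h, h'] with y hy hy' v hv μ hμ c hc hcε
    rcases hv with hv | hv
    · exact hy v hv μ ((le_max_left _ _).trans hμ) c hc (hcε.trans (min_le_left _ _))
    · exact hy' v hv μ ((le_max_right _ _).trans hμ) c hc (hcε.trans (min_le_right _ _))
  · intro v hv
    have hv0 : v ≠ 0 := by
      rintro rfl
      simp at hv
    obtain ⟨Λ, hΛ, h0⟩ : ∃ Λ : ℝ, 0 < Λ ∧ 0 < q x v + Λ * d x v ^ 2 := by
      by_cases hdv : d x v = 0
      · exact ⟨1, one_pos, by simpa [hdv] using hpos v hv0 hdv⟩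
      · have h1 : 0 < d x v ^ 2 := by positivity
        refine ⟨(|q x v| + 1) / d x v ^ 2, by positivity, ?_⟩
        rw [div_mul_cancel₀ _ h1.ne']
        linarith [neg_abs_le (q x v)]
    obtain ⟨ε, hε, h1⟩ : ∃ ε : ℝ, 0 < ε ∧ ε * m x v < q x v + Λ * d x v ^ 2 := by
      refine ⟨(q x v + Λ * d x v ^ 2) / (|m x v| + 1), by positivity, ?_⟩
      rw [div_mul_eq_mul_div, div_lt_iff₀ (by positivity)]
      exact mul_lt_mul_of_pos_left (by linarith [le_abs_self (m x v)]) h0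
    have hcont : ContinuousAt (fun y : E × E ↦ q y.1 y.2 + Λ * d y.1 y.2 ^ 2) (x, v) :=
      (hq v).add (((hd v).pow 2).const_mul Λ)
    have e : ∀ᶠ y in 𝓝 (x, v), 0 < q y.1 y.2 + Λ * d y.1 y.2 ^ 2 ∧
        ε * m y.1 y.2 < q y.1 y.2 + Λ * d y.1 y.2 ^ 2 :=
      (hcont.eventually (lt_mem_nhds h0)).and
        (((hm v).const_mul ε).eventually_lt hcont h1)
    rw [nhds_prod_eq, eventually_prod_iff] at e
    obtain ⟨pa, ha, pb, hb, hab⟩ := e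
    refine ⟨{w | pb w}, mem_nhdsWithin_of_mem_nhds hb, Λ, ε, hΛ, hε,
      ha.mono fun y hy w hw μ hμ c hc hcε ↦ ?_⟩
    obtain ⟨h2, h3⟩ := hab hy hw
    have h4 : Λ * d y w ^ 2 ≤ μ * d y w ^ 2 := by gcongr
    refine le_trans ?_ (add_le_add_right h4 _)
    -- As `m` is indefinite, both `0` and `ε m` are needed as lower bounds to reach all `c ≤ ε`.
    rcases le_total (m y w) 0 with h5 | h5
    · exact (mul_nonpos_of_nonneg_of_nonpos hc h5).trans h2.le
    · exact (mul_le_mul_of_nonneg_right hcε h5).trans h3.le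

end Flat

/-! ### The metric in charts -/

section Chart

set_option maxSynthPendingDepth 3

variable {n : ℕ} {N : Type*} [TopologicalSpace N]
  [ChartedSpace (EuclideanSpace ℝ (Fin (n + 1))) N] [IsManifold (𝓡 (n + 1)) ∞ N]
  (g : LorentzianMetric n N)

/-- A Lorentzian metric is nondegenerate. -/
theorem LorentzianMetric.eq_zero_of_inner_eq_zero (p : N) (v : TangentSpace (𝓡 (n + 1)) p)
    (h : ∀ w, g.inner p v w = 0) : v = 0 := by
  obtain ⟨u, -, hu⟩ := g.lorentzian p
  by_contra hv
  exact (hu v (by rw [g.symm, h]) hv).ne' (h v)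

theorem coordMetric_apply (p : N) (x v w : EuclideanSpace ℝ (Fin (n + 1))) :
    coordMetric g p x v w = g.inner ((extChartAt (𝓡 (n + 1)) p).symm x)
      (mfderiv 𝓘(ℝ, EuclideanSpace ℝ (Fin (n + 1))) (𝓡 (n + 1))
        (extChartAt (𝓡 (n + 1)) p).symm x v)
      (mfderiv 𝓘(ℝ, EuclideanSpace ℝ (Fin (n + 1))) (𝓡 (n + 1))
        (extChartAt (𝓡 (n + 1)) p).symm x w) :=
  rfl

theorem coordMetric_symm (p : N) (x v w : EuclideanSpace ℝ (Fin (n + 1))) :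
    coordMetric g p x v w = coordMetric g p x w v := by
  rw [coordMetric_apply, coordMetric_apply, g.symm]

theorem isInvertible_coordMetric (p : N) {x : EuclideanSpace ℝ (Fin (n + 1))}
    (hx : x ∈ (extChartAt (𝓡 (n + 1)) p).target) : (coordMetric g p x).IsInvertible := by
  have hA := isInvertible_mfderivWithin_extChartAt_symm (I := 𝓡 (n + 1)) hx
  rw [ModelWithCorners.Boundaryless.range_eq_univ, mfderivWithin_univ] at hA
  have hinj : Function.Injective (coordMetric g p x) := by
    rw [injective_iff_map_eq_zero]
    intro v hv
    refine hA.injective (Eq.trans ?_ (map_zero _).symm)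
    refine g.eq_zero_of_inner_eq_zero _ _ fun w ↦ ?_
    obtain ⟨w, rfl⟩ := hA.surjective w
    exact DFunLike.congr_fun hv w
  let L := (coordMetric g p x).toLinearMap
  have hfr : Module.finrank ℝ (EuclideanSpace ℝ (Fin (n + 1))) =
      Module.finrank ℝ (EuclideanSpace ℝ (Fin (n + 1)) →L[ℝ] ℝ) := by
    rw [← (LinearMap.toContinuousLinearMap :
      (EuclideanSpace ℝ (Fin (n + 1)) →ₗ[ℝ] ℝ) ≃ₗ[ℝ] _).finrank_eq]
    exact (Subspace.dual_finrank_eq).symm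
  exact ⟨(LinearEquiv.ofInjectiveOfFinrankEq L hinj hfr).toContinuousLinearEquiv, rfl⟩

/-- The coefficients of a smooth metric in a chart are smooth: it suffices to pair the metric with
coordinate vector fields, which are sections of the tangent bundle smooth over the chart. -/
theorem contDiffOn_coordMetric (p : N) :
    ContDiffOn ℝ ∞ (coordMetric g p) (extChartAt (𝓡 (n + 1)) p).target := by
  rw [contDiffOn_clm_apply]
  intro v
  rw [contDiffOn_clm_apply]
  intro w y hy
  have ht := isOpen_extChartAt_target (I := 𝓡 (n + 1)) p
  have hsec : ∀ u : EuclideanSpace ℝ (Fin (n + 1)),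
      ContMDiffAt 𝓘(ℝ, EuclideanSpace ℝ (Fin (n + 1))) (𝓡 (n + 1)).tangent ∞
        (fun z ↦ (⟨(extChartAt (𝓡 (n + 1)) p).symm z,
          mfderiv 𝓘(ℝ, EuclideanSpace ℝ (Fin (n + 1))) (𝓡 (n + 1))
            (extChartAt (𝓡 (n + 1)) p).symm z u⟩ : TangentBundle (𝓡 (n + 1)) N)) y := by
    intro u
    have h1 := (contMDiffOn_extChartAt_symm (I := 𝓡 (n + 1)) (n := ∞)
      p).contMDiffOn_tangentMapWithin (m := ∞) (by simp) ht.uniqueMDiffOn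
    have h2 : ContMDiff 𝓘(ℝ, EuclideanSpace ℝ (Fin (n + 1)))
        𝓘(ℝ, EuclideanSpace ℝ (Fin (n + 1))).tangent ∞
        (fun z ↦ (⟨z, u⟩ : TangentBundle 𝓘(ℝ, EuclideanSpace ℝ (Fin (n + 1)))
          (EuclideanSpace ℝ (Fin (n + 1))))) :=
      contMDiff_vectorSpace_iff_contDiff.2 contDiff_const
    have h3 := (h1.comp h2.contMDiffOn (s := (extChartAt (𝓡 (n + 1)) p).target)
      fun z hz ↦ hz).contMDiffAt (ht.mem_nhds hy)
    refine h3.congr_of_eventuallyEq ?_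
    filter_upwards [ht.mem_nhds hy] with z hz
    simp only [Function.comp_apply, tangentMapWithin, mfderivWithin_of_isOpen ht hz]
  have hsym : ContMDiffAt 𝓘(ℝ, EuclideanSpace ℝ (Fin (n + 1))) (𝓡 (n + 1)) ∞
      (extChartAt (𝓡 (n + 1)) p).symm y :=
    (contMDiffOn_extChartAt_symm p).contMDiffAt (ht.mem_nhds hy)
  have h := ContMDiffAt.clm_bundle_apply₂ (F₃ := ℝ) (E₃ := fun _ : N ↦ ℝ)
    (g.contMDiff.contMDiffAt.comp y hsym) (hsec v) (hsec w)
  rw [Bundle.contMDiffAt_totalSpace] at h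
  exact (contMDiffAt_iff_contDiffAt.1 h.2).contDiffWithinAt

/-- Scalar products at equal points agree. The vectors are taken in the model space, so that they
can be compared although the tangent spaces are only propositionally equal. -/
theorem LorentzianMetric.inner_congr {p q : N} (h : p = q)
    {a b a' b' : EuclideanSpace ℝ (Fin (n + 1))} (ha : a = a') (hb : b = b') :
    g.inner p a b = g.inner q a' b' := by
  subst h ha hb
  rfl

theorem coordMetric_self (p : N) (v w : EuclideanSpace ℝ (Fin (n + 1))) :
    coordMetric g p (extChartAt (𝓡 (n + 1)) p p) v w = g.inner p v w := by
  have h := mfderivWithin_range_extChartAt_symm (I := 𝓡 (n + 1)) (x := p)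
  rw [ModelWithCorners.Boundaryless.range_eq_univ, mfderivWithin_univ] at h
  exact g.inner_congr (extChartAt_to_inv p) (DFunLike.congr_fun h v) (DFunLike.congr_fun h w)

theorem contDiffAt_coordChange (p q : N) {y : EuclideanSpace ℝ (Fin (n + 1))}
    (hy : y ∈ (extChartAt (𝓡 (n + 1)) q).target)
    (hy' : (extChartAt (𝓡 (n + 1)) q).symm y ∈ (extChartAt (𝓡 (n + 1)) p).source) :
    ContDiffAt ℝ ∞ (extChartAt (𝓡 (n + 1)) p ∘ (extChartAt (𝓡 (n + 1)) q).symm) y := by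
  have h := contDiffWithinAt_ext_coord_change (I := 𝓡 (n + 1)) (n := ∞) p q (y := y)
    (by rw [PartialEquiv.trans_source]; exact ⟨hy, hy'⟩)
  rwa [ModelWithCorners.Boundaryless.range_eq_univ, contDiffWithinAt_univ] at h

/-- In the overlap of two charts, the coordinate expressions of the metric are related by the
derivative of the change of coordinates. -/
theorem coordMetric_coordChange (p q : N) {y : EuclideanSpace ℝ (Fin (n + 1))}
    (hy : y ∈ (extChartAt (𝓡 (n + 1)) q).target)
    (hy' : (extChartAt (𝓡 (n + 1)) q).symm y ∈ (extChartAt (𝓡 (n + 1)) p).source)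
    (v w : EuclideanSpace ℝ (Fin (n + 1))) :
    coordMetric g q y v w =
      coordMetric g p (extChartAt (𝓡 (n + 1)) p ((extChartAt (𝓡 (n + 1)) q).symm y))
        (fderiv ℝ (extChartAt (𝓡 (n + 1)) p ∘ (extChartAt (𝓡 (n + 1)) q).symm) y v)
        (fderiv ℝ (extChartAt (𝓡 (n + 1)) p ∘ (extChartAt (𝓡 (n + 1)) q).symm) y w) := by
  set φ := extChartAt (𝓡 (n + 1)) p with hφ
  set θ := φ ∘ (extChartAt (𝓡 (n + 1)) q).symm with hθ
  have hs : ∀ᶠ z in 𝓝 y, (extChartAt (𝓡 (n + 1)) q).symm z ∈ φ.source :=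
    (continuousAt_extChartAt_symm'' hy).eventually
      ((isOpen_extChartAt_source (I := 𝓡 (n + 1)) p).mem_nhds hy')
  have he : (extChartAt (𝓡 (n + 1)) q).symm =ᶠ[𝓝 y] φ.symm ∘ θ := by
    filter_upwards [hs] with z hz using (φ.left_inv hz).symm
  have h1 : MDifferentiableAt 𝓘(ℝ, EuclideanSpace ℝ (Fin (n + 1))) (𝓡 (n + 1)) φ.symm (θ y) := by
    have := mdifferentiableWithinAt_extChartAt_symm (I := 𝓡 (n + 1)) (φ.map_source hy')
    rwa [ModelWithCorners.Boundaryless.range_eq_univ, mdifferentiableWithinAt_univ] at this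
  have h2 : MDifferentiableAt 𝓘(ℝ, EuclideanSpace ℝ (Fin (n + 1)))
      𝓘(ℝ, EuclideanSpace ℝ (Fin (n + 1))) θ y :=
    ((contDiffAt_coordChange p q hy hy').differentiableAt (by simp)).mdifferentiableAt
  have h3 := he.mfderiv_eq (I := 𝓘(ℝ, EuclideanSpace ℝ (Fin (n + 1)))) (I' := 𝓡 (n + 1))
  rw [mfderiv_comp y h1 h2, mfderiv_eq_fderiv] at h3
  exact g.inner_congr (φ.left_inv hy').symm (DFunLike.congr_fun h3 v) (DFunLike.congr_fun h3 w)

end Chart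

/-! ### Hessians and convexity estimates -/

section Estimate

set_option maxSynthPendingDepth 3

variable {n : ℕ} {N : Type*} [TopologicalSpace N]
  [ChartedSpace (EuclideanSpace ℝ (Fin (n + 1))) N]

theorem contDiffAt_comp_extChartAt_symm [IsManifold (𝓡 (n + 1)) ∞ N] {f : N → ℝ}
    (hf : ContMDiff (𝓡 (n + 1)) 𝓘(ℝ, ℝ) 2 f) (p : N) {y : EuclideanSpace ℝ (Fin (n + 1))}
    (hy : y ∈ (extChartAt (𝓡 (n + 1)) p).target) :
    ContDiffAt ℝ 2 (f ∘ (extChartAt (𝓡 (n + 1)) p).symm) y := by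
  rw [← contMDiffAt_iff_contDiffAt]
  have h := contMDiffOn_extChartAt_symm (I := 𝓡 (n + 1)) (n := ∞) p
  exact hf.contMDiffAt.comp y ((h.contMDiffAt
    ((isOpen_extChartAt_target (I := 𝓡 (n + 1)) p).mem_nhds hy)).of_le (by norm_cast))

theorem differential_eq_fderiv {f : N → ℝ} {p : N}
    (hf : MDifferentiableAt (𝓡 (n + 1)) 𝓘(ℝ, ℝ) f p) (v : EuclideanSpace ℝ (Fin (n + 1))) :
    differential f p v = fderiv ℝ (f ∘ (extChartAt (𝓡 (n + 1)) p).symm)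
      (extChartAt (𝓡 (n + 1)) p p) v := by
  have h : mfderiv (𝓡 (n + 1)) 𝓘(ℝ, ℝ) f p =
      fderiv ℝ (f ∘ (extChartAt (𝓡 (n + 1)) p).symm) (extChartAt (𝓡 (n + 1)) p p) := by
    refine hf.mfderiv.trans ?_
    rw [ModelWithCorners.Boundaryless.range_eq_univ, fderivWithin_univ]
    rfl
  exact DFunLike.congr_fun h v

theorem eventuallyEq_comp_coordChange (f : N → ℝ) {p q : N}
    (hq : q ∈ (extChartAt (𝓡 (n + 1)) p).source) :
    f ∘ (extChartAt (𝓡 (n + 1)) q).symm =ᶠ[𝓝 (extChartAt (𝓡 (n + 1)) q q)]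
      (f ∘ (extChartAt (𝓡 (n + 1)) p).symm) ∘
        (extChartAt (𝓡 (n + 1)) p ∘ (extChartAt (𝓡 (n + 1)) q).symm) := by
  have h : ∀ᶠ z in 𝓝 (extChartAt (𝓡 (n + 1)) q q),
      (extChartAt (𝓡 (n + 1)) q).symm z ∈ (extChartAt (𝓡 (n + 1)) p).source :=
    (continuousAt_extChartAt_symm q).eventually
      ((isOpen_extChartAt_source (I := 𝓡 (n + 1)) p).mem_nhds (by rwa [extChartAt_to_inv]))
  filter_upwards [h] with z hz
  simp only [Function.comp_apply, (extChartAt (𝓡 (n + 1)) p).left_inv hz]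

/-- The differential of the change of coordinates from the preferred chart at `q` to the one at
`p`, i.e. the coordinates of a vector in `T_q N` with respect to the chart at `p`. -/
noncomputable def coordVector (p q : N) :
    EuclideanSpace ℝ (Fin (n + 1)) →L[ℝ] EuclideanSpace ℝ (Fin (n + 1)) :=
  fderiv ℝ (extChartAt (𝓡 (n + 1)) p ∘ (extChartAt (𝓡 (n + 1)) q).symm)
    (extChartAt (𝓡 (n + 1)) q q)

variable [IsManifold (𝓡 (n + 1)) ∞ N] (g : LorentzianMetric n N)

theorem inner_eq_coordMetric {p q : N} (hq : q ∈ (extChartAt (𝓡 (n + 1)) p).source)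
    (v w : EuclideanSpace ℝ (Fin (n + 1))) :
    g.inner q v w = coordMetric g p (extChartAt (𝓡 (n + 1)) p q) (coordVector p q v)
      (coordVector p q w) := by
  rw [← coordMetric_self, coordMetric_coordChange g p q (mem_extChartAt_target q)
    (by rwa [extChartAt_to_inv]), extChartAt_to_inv]
  rfl

theorem differential_eq_fderiv_coordVector {f : N → ℝ} (hf : ContMDiff (𝓡 (n + 1)) 𝓘(ℝ, ℝ) 2 f)
    {p q : N} (hq : q ∈ (extChartAt (𝓡 (n + 1)) p).source)
    (v : EuclideanSpace ℝ (Fin (n + 1))) :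
    differential f q v = fderiv ℝ (f ∘ (extChartAt (𝓡 (n + 1)) p).symm)
      (extChartAt (𝓡 (n + 1)) p q) (coordVector p q v) := by
  have hq' : (extChartAt (𝓡 (n + 1)) q).symm (extChartAt (𝓡 (n + 1)) q q) ∈
      (extChartAt (𝓡 (n + 1)) p).source := by rwa [extChartAt_to_inv]
  have e : (extChartAt (𝓡 (n + 1)) p ∘ (extChartAt (𝓡 (n + 1)) q).symm)
      (extChartAt (𝓡 (n + 1)) q q) = extChartAt (𝓡 (n + 1)) p q := by
    rw [Function.comp_apply, extChartAt_to_inv]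
  rw [differential_eq_fderiv (hf.mdifferentiable (by simp) q),
    (eventuallyEq_comp_coordChange f hq).fderiv_eq, fderiv_comp, e]
  · rfl
  · rw [e]
    exact (contDiffAt_comp_extChartAt_symm hf p
      ((extChartAt (𝓡 (n + 1)) p).map_source hq)).differentiableAt (by simp)
  · exact (contDiffAt_coordChange p q (mem_extChartAt_target q) hq').differentiableAt (by simp)

/-- The Hessian at `q`, defined in the preferred chart at `q`, may be computed in any other
preferred chart. -/
theorem hessian_eq_flatHessian_coordVector {f : N → ℝ} (hf : ContMDiff (𝓡 (n + 1)) 𝓘(ℝ, ℝ) 2 f)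
    {p q : N} (hq : q ∈ (extChartAt (𝓡 (n + 1)) p).source)
    (v w : EuclideanSpace ℝ (Fin (n + 1))) :
    hessian g f q v w = flatHessian (coordMetric g p) (f ∘ (extChartAt (𝓡 (n + 1)) p).symm)
      (extChartAt (𝓡 (n + 1)) p q) (coordVector p q v) (coordVector p q w) := by
  have hq' : (extChartAt (𝓡 (n + 1)) q).symm (extChartAt (𝓡 (n + 1)) q q) ∈
      (extChartAt (𝓡 (n + 1)) p).source := by rwa [extChartAt_to_inv]
  have hqt := (extChartAt (𝓡 (n + 1)) p).map_source hq
  set θ := extChartAt (𝓡 (n + 1)) p ∘ (extChartAt (𝓡 (n + 1)) q).symm with hθ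
  have e : θ (extChartAt (𝓡 (n + 1)) q q) = extChartAt (𝓡 (n + 1)) p q := by
    rw [hθ, Function.comp_apply, extChartAt_to_inv]
  have hG : ∀ r : N, ∀ y ∈ (extChartAt (𝓡 (n + 1)) r).target,
      DifferentiableAt ℝ (coordMetric g r) y := fun r y hy ↦
    ((contDiffOn_coordMetric g r).contDiffAt
      ((isOpen_extChartAt_target (I := 𝓡 (n + 1)) r).mem_nhds hy)).differentiableAt (by simp)
  have hi := isInvertible_coordMetric g q (mem_extChartAt_target (I := 𝓡 (n + 1)) q)
  have hs : Function.Surjective (fderiv ℝ θ (extChartAt (𝓡 (n + 1)) q q)) := by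
    -- A vector in the kernel would be orthogonal to all others for the metric in the chart at `q`.
    refine (LinearMap.injective_iff_surjective
      (f := (fderiv ℝ θ (extChartAt (𝓡 (n + 1)) q q)).toLinearMap)).1 ?_
    rw [injective_iff_map_eq_zero]
    intro a ha
    refine hi.injective (Eq.trans ?_ (map_zero _).symm)
    ext b
    rw [coordMetric_coordChange g p q (mem_extChartAt_target q) hq', ← hθ]
    erw [ha]
    simp
  have hev : ∀ᶠ y in 𝓝 (extChartAt (𝓡 (n + 1)) q q), ∀ a b, coordMetric g q y a b =
      coordMetric g p (θ y) (fderiv ℝ θ y a) (fderiv ℝ θ y b) := by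
    have h1 : ∀ᶠ z in 𝓝 (extChartAt (𝓡 (n + 1)) q q),
        (extChartAt (𝓡 (n + 1)) q).symm z ∈ (extChartAt (𝓡 (n + 1)) p).source :=
      (continuousAt_extChartAt_symm q).eventually
        ((isOpen_extChartAt_source (I := 𝓡 (n + 1)) p).mem_nhds hq')
    filter_upwards [h1, extChartAt_target_mem_nhds q] with y hy hy' a b using
      coordMetric_coordChange g p q hy' hy a b
  have h := flatHessian_comp (θ := θ) (F := f ∘ (extChartAt (𝓡 (n + 1)) p).symm)
    (by rw [e]; exact hG p _ hqt) (hG q _ (mem_extChartAt_target q))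
    (by rw [e]; exact contDiffAt_comp_extChartAt_symm hf p hqt)
    ((contDiffAt_coordChange p q (mem_extChartAt_target q) hq').of_le (by norm_cast))
    hev (coordMetric_symm g p _) (by rw [e]; exact isInvertible_coordMetric g p hqt) hi hs v w
  -- By definition, `hessian g f q` is the flat Hessian in the chart at `q`.
  rw [e, ← flatHessian_congr (eventuallyEq_comp_coordChange f hq)] at h
  exact h

theorem hessian_exp_mul {f : N → ℝ} (hf : ContMDiff (𝓡 (n + 1)) 𝓘(ℝ, ℝ) 2 f) (μ : ℝ) (p : N)
    (v : EuclideanSpace ℝ (Fin (n + 1))) :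
    hessian g (fun q ↦ Real.exp (μ * f q)) p v v =
      μ * Real.exp (μ * f p) * (hessian g f p v v + μ * differential f p v ^ 2) := by
  have h := flatHessian_exp_mul (G := coordMetric g p) μ
    (contDiffAt_comp_extChartAt_symm hf p (mem_extChartAt_target p)) v v
  rw [Function.comp_apply, extChartAt_to_inv,
    ← differential_eq_fderiv (hf.mdifferentiable (by simp) p), ← sq] at h
  exact h

/-- Local form of the convexity estimate, with one pair of constants for all points near `p`. In the
chart at `p`, all quantities involved depend continuously on the point. -/
theorem exists_nhds_hessian_estimate {f : N → ℝ} (hf : ContMDiff (𝓡 (n + 1)) 𝓘(ℝ, ℝ) 2 f) (p : N)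
    (hpos : ∀ v : EuclideanSpace ℝ (Fin (n + 1)), v ≠ 0 → differential f p v = 0 →
      0 < hessian g f p v v) :
    ∃ Λ ε : ℝ, 0 < Λ ∧ 0 < ε ∧ ∀ᶠ q in 𝓝 p, ∀ v : EuclideanSpace ℝ (Fin (n + 1)), ∀ μ, Λ ≤ μ →
      ∀ c, 0 ≤ c → c ≤ ε →
        c * g.inner q v v ≤ hessian g f q v v + μ * differential f q v ^ 2 := by
  have hp := mem_extChartAt_target (I := 𝓡 (n + 1)) p
  have hG : ContDiffAt ℝ 1 (coordMetric g p) (extChartAt (𝓡 (n + 1)) p p) :=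
    ((contDiffOn_coordMetric g p).contDiffAt (extChartAt_target_mem_nhds p)).of_le
      (by norm_cast)
  have hF := contDiffAt_comp_extChartAt_symm hf p hp
  obtain ⟨Λ, ε, hΛ, hε, h⟩ := exists_forall_le_add_mul_sq
    (q := fun y v ↦ flatHessian (coordMetric g p) (f ∘ (extChartAt (𝓡 (n + 1)) p).symm) y v v)
    (d := fun y v ↦ fderiv ℝ (f ∘ (extChartAt (𝓡 (n + 1)) p).symm) y v)
    (m := fun y v ↦ coordMetric g p y v v) (x := extChartAt (𝓡 (n + 1)) p p)
    (fun v ↦ continuousAt_flatHessian hG hF (isInvertible_coordMetric g p hp))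
    (fun v ↦ (ContinuousAt.comp (f := Prod.fst) (x := (_, v))
      (hF.fderiv_right (m := 1) (by norm_num)).continuousAt continuousAt_fst).clm_apply
        continuousAt_snd)
    (fun v ↦ ((ContinuousAt.comp (f := Prod.fst) (x := (_, v)) hG.continuousAt
      continuousAt_fst).clm_apply continuousAt_snd).clm_apply continuousAt_snd)
    (fun y r v ↦ flatHessian_smul_smul _ _ y r v)
    (fun y r v ↦ by rw [map_smul, smul_eq_mul])
    (fun y r v ↦ by
      simp only [map_smul, smul_apply, smul_eq_mul]
      ring)
    (fun v hv hd ↦ hpos v hv (by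
      rwa [differential_eq_fderiv (hf.mdifferentiable (by simp) p)]))
  refine ⟨Λ, ε, hΛ, hε, ?_⟩
  filter_upwards [(continuousAt_extChartAt (I := 𝓡 (n + 1)) p).eventually h,
    extChartAt_source_mem_nhds (I := 𝓡 (n + 1)) p] with q hq hqs v μ hμ c hc hcε
  rw [inner_eq_coordMetric g hqs, hessian_eq_flatHessian_coordVector g hf hqs,
    differential_eq_fderiv_coordVector hf hqs]
  exact hq _ μ hμ c hc hcε

/-- A function whose Hessian is positive definite on the kernel of its differential, i.e. along
its level sets, becomes strictly convex on a given compact set after exponentiation with a large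
factor. -/
theorem exists_strictlyConvexOn_exp_mul {f : N → ℝ} (hf : ContMDiff (𝓡 (n + 1)) 𝓘(ℝ, ℝ) 2 f)
    {K : Set N} (hK : IsCompact K)
    (hpos : ∀ p ∈ K, ∀ v : EuclideanSpace ℝ (Fin (n + 1)), v ≠ 0 → differential f p v = 0 →
      0 < hessian g f p v v) :
    ∃ Λ : ℝ, 0 < Λ ∧ ∀ μ : ℝ, Λ ≤ μ → StrictlyConvexOn g (fun p ↦ Real.exp (μ * f p)) K := by
  obtain ⟨Λ, ε, hΛ, hε, h⟩ : ∃ Λ ε : ℝ, 0 < Λ ∧ 0 < ε ∧ ∀ q ∈ K,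
      ∀ v : EuclideanSpace ℝ (Fin (n + 1)), ∀ μ, Λ ≤ μ → ∀ c, 0 ≤ c → c ≤ ε →
        c * g.inner q v v ≤ hessian g f q v v + μ * differential f q v ^ 2 := by
    refine hK.induction_on (p := fun s ↦ ∃ Λ ε : ℝ, 0 < Λ ∧ 0 < ε ∧ ∀ q ∈ s,
      ∀ v : EuclideanSpace ℝ (Fin (n + 1)), ∀ μ, Λ ≤ μ → ∀ c, 0 ≤ c → c ≤ ε →
        c * g.inner q v v ≤ hessian g f q v v + μ * differential f q v ^ 2)
      ⟨1, 1, by simp⟩ ?_ ?_ ?_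
    · rintro s t hst ⟨Λ, ε, hΛ, hε, h⟩
      exact ⟨Λ, ε, hΛ, hε, fun q hq ↦ h q (hst hq)⟩
    · rintro s t ⟨Λ, ε, hΛ, hε, h⟩ ⟨Λ', ε', hΛ', hε', h'⟩
      refine ⟨max Λ Λ', min ε ε', by positivity, by positivity, fun q hq v μ hμ c hc hcε ↦ ?_⟩
      rcases hq with hq | hq
      · exact h q hq v μ ((le_max_left _ _).trans hμ) c hc (hcε.trans (min_le_left _ _))
      · exact h' q hq v μ ((le_max_right _ _).trans hμ) c hc (hcε.trans (min_le_right _ _))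
    · intro p hp
      obtain ⟨Λ, ε, hΛ, hε, h⟩ := exists_nhds_hessian_estimate g hf p (hpos p hp)
      exact ⟨_, mem_nhdsWithin_of_mem_nhds h, Λ, ε, hΛ, hε, fun q hq ↦ hq⟩
  refine ⟨Λ, hΛ, fun μ hμ ↦ ⟨⟨univ, isOpen_univ, subset_univ K, ?_⟩, ?_⟩⟩
  · exact (Real.contDiff_exp.contMDiff.comp
      ((contDiff_const.mul contDiff_id).contMDiff.comp hf :
        ContMDiff (𝓡 (n + 1)) 𝓘(ℝ, ℝ) 2 fun p ↦ μ * f p)).contMDiffOn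
  · have hμ0 : 0 < μ := hΛ.trans_le hμ
    obtain ⟨b, hb⟩ := (hK.image hf.continuous).bddBelow
    refine ⟨μ * Real.exp (μ * b) * ε, by positivity, fun p hp v ↦ ?_⟩
    refine le_of_le_of_eq ?_ (hessian_exp_mul g hf μ p v).symm
    have hbp : b ≤ f p := hb (mem_image_of_mem f hp)
    -- The estimate is used with the factor `c = e^{μ (b - f p)} ε ≤ ε`.
    have h1 := h p hp v μ hμ (Real.exp (μ * (b - f p)) * ε) (by positivity)
      (mul_le_of_le_one_left hε.le
        (Real.exp_le_one_iff.2 (mul_nonpos_of_nonneg_of_nonpos hμ0.le (by linarith))))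
    have h2 : Real.exp (μ * b) = Real.exp (μ * f p) * Real.exp (μ * (b - f p)) := by
      rw [← Real.exp_add]
      ring_nf
    have h3 := mul_le_mul_of_nonneg_left h1 (by positivity : 0 ≤ μ * Real.exp (μ * f p))
    rw [h2]
    linarith

end Estimate

/-! ### Level hypersurfaces of the time function -/

section Slices

set_option maxSynthPendingDepth 3

variable {n : ℕ} {N : Type*} [TopologicalSpace N]
  [ChartedSpace (EuclideanSpace ℝ (Fin (n + 1))) N] [IsManifold (𝓡 (n + 1)) ∞ N]
  (g : LorentzianMetric n N)
  {S : Type*} [TopologicalSpace S] [ChartedSpace (EuclideanSpace ℝ (Fin n)) S]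

/-- The second fundamental form of a hypersurface contained in a level set of `f`, with respect to
a normal `ν` satisfying `⟨ν, ·⟩ = k df`, is the restriction of `k` times the Hessian of `f`. -/
theorem secondFundamentalForm_eq_mul_hessian {f : N → ℝ} (hf : ContMDiff (𝓡 (n + 1)) 𝓘(ℝ, ℝ) 2 f)
    {F : S → N} {s : S} (hF : ContMDiffAt (𝓡 n) (𝓡 (n + 1)) 2 F s) {t : ℝ}
    (ht : ∀ s, f (F s) = t) {ν : TangentSpace (𝓡 (n + 1)) (F s)} {k : ℝ}
    (hν : ∀ u, g.inner (F s) u ν = k * differential f (F s) u) (v w : EuclideanSpace ℝ (Fin n)) :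
    secondFundamentalForm g F s ν v w = k * hessian g f (F s)
      (mfderiv (𝓡 n) (𝓡 (n + 1)) F s v) (mfderiv (𝓡 n) (𝓡 (n + 1)) F s w) := by
  set X : EuclideanSpace ℝ (Fin n) → EuclideanSpace ℝ (Fin (n + 1)) :=
    extChartAt (𝓡 (n + 1)) (F s) ∘ F ∘ (extChartAt (𝓡 n) s).symm with hXdef
  set y := extChartAt (𝓡 n) s s with hy
  have hX : ContDiffAt ℝ 2 X y := by
    have := (contMDiffAt_iff.1 hF).2
    rwa [ModelWithCorners.Boundaryless.range_eq_univ, contDiffWithinAt_univ] at this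
  have hXy : X y = extChartAt (𝓡 (n + 1)) (F s) (F s) := by
    simp only [hXdef, hy, Function.comp_apply, extChartAt_to_inv]
  have hmf : mfderiv (𝓡 n) (𝓡 (n + 1)) F s = fderiv ℝ X y := by
    refine (hF.mdifferentiableAt (by simp)).mfderiv.trans ?_
    rw [ModelWithCorners.Boundaryless.range_eq_univ, fderivWithin_univ]
    rfl
  have hFc : ContDiffAt ℝ 2 (f ∘ (extChartAt (𝓡 (n + 1)) (F s)).symm) (X y) := by
    rw [hXy]
    exact contDiffAt_comp_extChartAt_symm hf _ (mem_extChartAt_target _)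
  have hconst : (f ∘ (extChartAt (𝓡 (n + 1)) (F s)).symm) ∘ X =ᶠ[𝓝 y] fun _ ↦ t := by
    have h1 : ContinuousAt (F ∘ (extChartAt (𝓡 n) s).symm) y :=
      ContinuousAt.comp (by rw [hy, extChartAt_to_inv]; exact hF.continuousAt)
        (continuousAt_extChartAt_symm s)
    have h2 := h1.eventually ((isOpen_extChartAt_source (I := 𝓡 (n + 1)) (F s)).mem_nhds
      (by rw [Function.comp_apply, hy, extChartAt_to_inv]; exact mem_extChartAt_source (F s)))
    filter_upwards [h2] with z hz
    have := (extChartAt (𝓡 (n + 1)) (F s)).left_inv hz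
    simp only [Function.comp_apply] at this
    simp only [hXdef, Function.comp_apply, this, ht]
  have h0 : fderiv ℝ (fderiv ℝ ((f ∘ (extChartAt (𝓡 (n + 1)) (F s)).symm) ∘ X)) y v w = 0 := by
    rw [hconst.fderiv.fderiv_eq]
    simp
  have h1 := fderiv_fderiv_comp_apply hFc hX v w
  rw [hXy] at h1
  rw [hmf]
  set a := fderiv ℝ (fderiv ℝ X) y v w with ha
  set b := christoffel g (F s) (fderiv ℝ X y v) (fderiv ℝ X y w) with hb
  have h2 : secondFundamentalForm g F s ν v w = -g.inner (F s) (a + b) ν := rfl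
  have h3 : hessian g f (F s) (fderiv ℝ X y v) (fderiv ℝ X y w) =
      fderiv ℝ (fderiv ℝ (f ∘ (extChartAt (𝓡 (n + 1)) (F s)).symm))
        (extChartAt (𝓡 (n + 1)) (F s) (F s)) (fderiv ℝ X y v) (fderiv ℝ X y w) -
      fderiv ℝ (f ∘ (extChartAt (𝓡 (n + 1)) (F s)).symm)
        (extChartAt (𝓡 (n + 1)) (F s) (F s)) b := rfl
  have h4 : differential f (F s) (a + b) = fderiv ℝ (f ∘ (extChartAt (𝓡 (n + 1)) (F s)).symm)
      (extChartAt (𝓡 (n + 1)) (F s) (F s)) a + fderiv ℝ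
        (f ∘ (extChartAt (𝓡 (n + 1)) (F s)).symm) (extChartAt (𝓡 (n + 1)) (F s) (F s)) b :=
    (differential_eq_fderiv (hf.mdifferentiable (by simp) _) (a + b)).trans (map_add _ _ _)
  refine h2.trans (Eq.trans ?_ (congrArg (k * ·) h3).symm)
  refine (congrArg Neg.neg ((hν (a + b)).trans (congrArg (k * ·) h4))).trans ?_
  linear_combination k * h1 - k * h0

variable {g} {T : TimeOrientation g} [IsManifold (𝓡 n) ∞ S] {S₀ : Set N}

namespace SpecialCoordinates

variable (x : SpecialCoordinates g T S S₀)

theorem contMDiff_slice {t : ℝ} (ht : t ∈ x.I) :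
    ContMDiff (𝓡 n) (𝓡 (n + 1)) ∞ (x.slice t) := by
  have h : ContMDiff (𝓡 n) (𝓘(ℝ, ℝ).prod (𝓡 n)) ∞ fun s : S ↦ (t, s) :=
    contMDiff_const.prodMk contMDiff_id
  exact contMDiffOn_univ.1 (x.contMDiffOn_slice.comp h.contMDiffOn fun s _ ↦ ⟨ht, mem_univ _⟩)

theorem differential_mfderiv_slice {t : ℝ} (ht : t ∈ x.I) (s : S)
    (w : EuclideanSpace ℝ (Fin n)) :
    differential x.time (x.slice t s) (mfderiv (𝓡 n) (𝓡 (n + 1)) (x.slice t) s w) = 0 := by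
  have h := mfderiv_comp s (x.contMDiff_time.mdifferentiable (by simp) (x.slice t s))
    ((x.contMDiff_slice ht).mdifferentiable (by simp) s)
  have e : x.time ∘ x.slice t = fun _ ↦ t := funext fun s ↦ x.time_slice t ht s
  rw [e, mfderiv_const] at h
  exact (DFunLike.congr_fun h w).symm

theorem mfderiv_proj_mfderiv_slice {t : ℝ} (ht : t ∈ x.I) (s : S)
    (w : EuclideanSpace ℝ (Fin n)) :
    (mfderiv (𝓡 (n + 1)) (𝓡 n) x.proj (x.slice t s)
      (mfderiv (𝓡 n) (𝓡 (n + 1)) (x.slice t) s w) : EuclideanSpace ℝ (Fin n)) = w := by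
  have h := mfderiv_comp s (x.contMDiff_proj.mdifferentiable (by simp) (x.slice t s))
    ((x.contMDiff_slice ht).mdifferentiable (by simp) s)
  have e : x.proj ∘ x.slice t = id := funext fun s ↦ x.proj_slice t ht s
  rw [e, mfderiv_id] at h
  exact (DFunLike.congr_fun h w).symm

/-- The kernel of `dx⁰` consists of the tangent vectors of the slice. A vector in it and the image
of its projection have the same components `dx⁰` and `dπ`, hence the same products with all vectors,
by the form of the metric. -/
theorem exists_mfderiv_slice_eq {t : ℝ} (ht : t ∈ x.I) (s : S)
    (v : EuclideanSpace ℝ (Fin (n + 1))) (hv : differential x.time (x.slice t s) v = 0) :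
    ∃ w : EuclideanSpace ℝ (Fin n), mfderiv (𝓡 n) (𝓡 (n + 1)) (x.slice t) s w = v := by
  let w : EuclideanSpace ℝ (Fin n) := mfderiv (𝓡 (n + 1)) (𝓡 n) x.proj (x.slice t s) v
  refine ⟨w, ?_⟩
  let u : TangentSpace (𝓡 (n + 1)) (x.slice t s) := mfderiv (𝓡 n) (𝓡 (n + 1)) (x.slice t) s w
  let v' : TangentSpace (𝓡 (n + 1)) (x.slice t s) := v
  have hu : u - v' = 0 := by
    refine g.eq_zero_of_inner_eq_zero _ _ fun z ↦ ?_
    have h1 : differential x.time (x.slice t s) (u - v') = 0 :=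
      (map_sub _ _ _).trans (sub_eq_zero.2 ((x.differential_mfderiv_slice ht s w).trans hv.symm))
    have h2 : mfderiv (𝓡 (n + 1)) (𝓡 n) x.proj (x.slice t s) (u - v') = 0 :=
      (map_sub _ _ _).trans (sub_eq_zero.2 (x.mfderiv_proj_mfderiv_slice ht s w))
    rw [x.metric_eq, h1, h2]
    simp
  exact sub_eq_zero.1 hu

/-- A timelike unit normal of a slice that is past directed is a positive multiple of the
gradient of `x⁰`. -/
theorem exists_pos_inner_eq_mul_differential {t : ℝ} (ht : t ∈ x.I) (s : S)
    {ν : TangentSpace (𝓡 (n + 1)) (x.slice t s)} (hν : IsPastUnitNormal g T (x.slice t) s ν) :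
    ∃ k : ℝ, 0 < k ∧ ∀ u, g.inner (x.slice t s) u ν =
      k * differential x.time (x.slice t s) u := by
  obtain ⟨-, hpast, hnormal⟩ := hν
  have hT := T.timelike (x.slice t s)
  set τ := T.field (x.slice t s)
  have hd : 0 < differential x.time (x.slice t s) τ := by
    refine x.time_future _ _ ⟨?_, hT.le, hT⟩
    intro h
    change τ = 0 at h
    rw [h] at hT
    simp at hT
  refine ⟨g.inner _ ν τ / differential x.time (x.slice t s) τ, div_pos hpast hd, fun u ↦ ?_⟩
  set r := differential x.time (x.slice t s) u / differential x.time (x.slice t s) τ with hr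
  have h0 : differential x.time (x.slice t s) (u - r • τ) = 0 := by
    rw [map_sub, map_smul, smul_eq_mul, hr, div_mul_cancel₀ _ hd.ne', sub_self]
  obtain ⟨w, hw⟩ := x.exists_mfderiv_slice_eq ht s _ h0
  have h1 := hnormal w
  erw [hw] at h1
  rw [map_sub, map_smul, smul_eq_mul, sub_eq_zero] at h1
  rw [g.symm, h1, hr]
  ring

/-- Strict convexity of a slice makes the Hessian of `x⁰` positive definite along it. -/
theorem hessian_time_slice_pos {t : ℝ} (ht : t ∈ x.I)
    (hconv : StrictlyConvexHypersurface g T (x.slice t)) (s : S)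
    (v : EuclideanSpace ℝ (Fin (n + 1))) (hv : v ≠ 0)
    (hd : differential x.time (x.slice t s) v = 0) :
    0 < hessian g x.time (x.slice t s) v v := by
  obtain ⟨ν, hν, hpos⟩ := hconv s
  obtain ⟨k, hk, hkν⟩ := x.exists_pos_inner_eq_mul_differential ht s hν
  obtain ⟨w, rfl⟩ := x.exists_mfderiv_slice_eq ht s v hd
  have hw : w ≠ 0 := by
    rintro rfl
    exact hv (map_zero (mfderiv (𝓡 n) (𝓡 (n + 1)) (x.slice t) s))
  have h := hpos w hw
  have e := secondFundamentalForm_eq_mul_hessian g (x.contMDiff_time.of_le (by norm_cast))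
    ((x.contMDiff_slice ht s).of_le (by norm_cast)) (x.time_slice t ht) hkν w w
  exact pos_of_mul_pos_right (h.trans_eq e) hk.le

end SpecialCoordinates

end Slices

end Spacetime

theorem mainTheorem11 {n : ℕ}
    {N : Type*} [TopologicalSpace N] [T2Space N] [SecondCountableTopology N]
    [ChartedSpace (EuclideanSpace ℝ (Fin (n + 1))) N] [IsManifold (𝓡 (n + 1)) ∞ N]
    {S : Type*} [TopologicalSpace S]
    [ChartedSpace (EuclideanSpace ℝ (Fin n)) S] [IsManifold (𝓡 n) ∞ S]
    (g : Spacetime.LorentzianMetric n N) (T : Spacetime.TimeOrientation g)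
    (hN : Spacetime.GloballyHyperbolic g T)
    (S₀ : Set N) (hS₀ : Spacetime.IsCauchyHypersurface g T S₀)
    (x : Spacetime.SpecialCoordinates g T S S₀)
    (K : Set N) (hK : IsCompact K)
    (hconv : ∀ c : ℝ, (∃ p ∈ K, x.time p = c) →
      Spacetime.StrictlyConvexHypersurface g T (x.slice c)) :
    (∃ Λ : ℝ, 0 < Λ ∧ ∀ μ : ℝ, Λ ≤ μ →
      Spacetime.StrictlyConvexOn g (fun p ↦ Real.exp (μ * x.time p)) K) ∧
    ∃ χ : N → ℝ, Spacetime.StrictlyConvexOn g χ K := by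
  have h : ∃ Λ : ℝ, 0 < Λ ∧ ∀ μ : ℝ, Λ ≤ μ →
      Spacetime.StrictlyConvexOn g (fun p ↦ Real.exp (μ * x.time p)) K := by
    refine Spacetime.exists_strictlyConvexOn_exp_mul g
      (x.contMDiff_time.of_le (by norm_cast)) hK fun p hp v hv hd ↦ ?_
    have h1 := x.hessian_time_slice_pos (x.time_mem p) (hconv _ ⟨p, hp, rfl⟩) (x.proj p) v hv
    rw [x.slice_time_proj p] at h1
    exact h1 hd
  obtain ⟨Λ, hΛ, h'⟩ := h
  exact ⟨⟨Λ, hΛ, h'⟩, _, h' Λ le_rfl⟩
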